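/- All graphs are finite, simple and undirected. Let $G$ be a graph, and let every vertex be coloured blue or white. Under the *hopping colour change rule*, a blue vertex $v$ can force a white vertex $w$ to become blue if $v$ has not yet performed a force and every neighbour of $v$ is blue. For $B\subseteq V(G)$, a *set of forces of $B$* is the set $\mathcal F$ of all forces $v\to w$ performed when one starts with exactly $B$ blue and applies the rule, one force at a time, until no more forces are possible. Put $\mathcal F^{(0)}=B$, and for $t\ge 1$ let $\mathcal F^{(t)}$ be the set of vertices $w$ for which some force $v\to w$ in $\mathcal F$ is valid when exactly the vertices of $\bigcup_{i<t}\mathcal F^{(i)}$ are blue. Let $\operatorname{pt}_H(G;\mathcal F)$ be the least $t$ with $\bigcup_{i\le t}\mathcal F^{(i)}=V(G)$ ($\infty$ if there is none), let $\operatorname{pt}_H(G;B)$ be the minimum of $\operatorname{pt}_H(G;\mathcal F)$ over all sets of forces $\mathcal F$ of $B$, and let the *hopping throttling number* be $$\operatorname{th}_H(G)=\min_{B\subseteq V(G)}\bigl(|B|+\operatorname{pt}_H(G;B)\bigr).$$ For positive integers $k_1,\dots,k_r$, a graph $M$ is a *$(k_1,\dots,k_r)$-kangaroo* if $V(M)=\bigcup_{i=1}^r(S_i\cup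 T_i)$ for some sets with $|S_i|=|T_i|=k_i+1$ such that 1. the sets $S_1,\dots,S_r$ are pairwise disjoint, and so are $T_1,\dots,T_r$; 2. $S_i\cap T_j=\emptyset$, and no edge of $M$ joins $S_i$ to $T_j$, whenever $i\le j$; 3. for $2\le i\le r$, $S_i$ is dominated by $T_{i-1}$: every vertex of $S_i$ belongs to $T_{i-1}$ or has a neighbour in $T_{i-1}$. For an integer $k\ge 0$ let $\mathcal G_k$ be the class of all $(k_1,\dots,k_r)$-kangaroos with $k_1+\dots+k_r=k+1$. **Theorem.** Let $G$ be a graph and $k\ge 0$ an integer. Then $\operatorname{th}_H(G)\ge |V(G)|-k$ if and only if $G$ does not contain a graph in $\mathcal G_k$ as an induced subgraph. Consequently, $\operatorname{th}_H(G)=|V(G)|-k$ if and only if $G$ does not contain a graph in $\mathcal G_k$ as an induced subgraph and, in case $k\ge 1$, $G$ contains a graph in $\mathcal G_{k-1}$ as an induced subgraph. -/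

import Mathlib

namespace Hopping

/-- The hopping colour change rule. The set of blue vertices is `blue` and the set of vertices that
have already performed a force is `spent`. The blue vertex `v` can force the white vertex `w` if
`v` has not yet performed a force and every neighbour of `v` is blue. -/
def CanForce {V : Type*} (G : SimpleGraph V) (blue spent : Set V) (v w : V) : Prop :=
  v ∈ blue ∧ w ∉ blue ∧ v ∉ spent ∧ G.neighborSet v ⊆ blue

/-- The blue vertices after the forces in `L` have been performed, starting with `B` blue. -/
def blueAfter {V : Type*} (B : Set V) (L : List (V × V)) : Set V :=
  B ∪ {w | ∃ v, (v, w) ∈ L}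

/-- The vertices that perform one of the forces in `L`. -/
def spentAfter {V : Type*} (L : List (V × V)) : Set V :=
  {v | ∃ w, (v, w) ∈ L}

/-- `L` lists hopping forces that can be performed one after the other, starting with `B` blue.
The pair `(v, w)` stands for the force `v → w`. -/
inductive IsForceSequence {V : Type*} (G : SimpleGraph V) (B : Set V) : List (V × V) → Prop
  | nil : IsForceSequence G B []
  | snoc (L : List (V × V)) (v w : V) : IsForceSequence G B L →
      CanForce G (blueAfter B L) (spentAfter L) v w → IsForceSequence G B (L ++ [(v, w)])

/-- A chronological list of hopping forces of `B`: forces are performed until no more are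
possible. -/
def IsChronologicalList {V : Type*} (G : SimpleGraph V) (B : Set V) (L : List (V × V)) : Prop :=
  IsForceSequence G B L ∧ ∀ v w, ¬ CanForce G (blueAfter B L) (spentAfter L) v w

/-- A set of hopping forces of `B`: the unordered set of forces of a chronological list. -/
def IsSetOfForces {V : Type*} (G : SimpleGraph V) (B : Set V) (F : Set (V × V)) : Prop :=
  ∃ L : List (V × V), IsChronologicalList G B L ∧ F = {e | e ∈ L}

/-- The white vertices that become blue in one time step using `F` when exactly the vertices in
`blue` are blue. The vertices that have already forced are those `v` whose force `v → x` in `F` has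
`x` blue. -/
def forcedNext {V : Type*} (G : SimpleGraph V) (F : Set (V × V)) (blue : Set V) : Set V :=
  {w | ∃ v, (v, w) ∈ F ∧ CanForce G blue {u | ∃ x ∈ blue, (u, x) ∈ F} v w}

/-- The set of vertices that are blue after `t` time steps, that is, the union
`F⁽⁰⁾ ∪ ⋯ ∪ F⁽ᵗ⁾`, where `F⁽⁰⁾ = B` and `F⁽ᵗ⁺¹⁾ = forcedNext G F (F⁽⁰⁾ ∪ ⋯ ∪ F⁽ᵗ⁾)`. -/
def blueAt {V : Type*} (G : SimpleGraph V) (B : Set V) (F : Set (V × V)) : ℕ → Set V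
  | 0 => B
  | t + 1 => blueAt G B F t ∪ forcedNext G F (blueAt G B F t)

/-- The hopping propagation time of the set of forces `F` of `B`: the least `t` such that all
vertices are blue after `t` time steps, and `⊤` if there is none. -/
noncomputable def propTimeOfForces {V : Type*} (G : SimpleGraph V) (B : Set V)
    (F : Set (V × V)) : ℕ∞ :=
  ⨅ (t : ℕ) (_ : blueAt G B F t = Set.univ), (t : ℕ∞)

/-- The hopping propagation time of `B`: the minimum over all sets of hopping forces of `B`. -/
noncomputable def propTime {V : Type*} (G : SimpleGraph V) (B : Set V) : ℕ∞ :=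
  ⨅ (F : Set (V × V)) (_ : IsSetOfForces G B F), propTimeOfForces G B F

/-- The hopping throttling number `th_H(G)`: the minimum of `|B| + pt_H(G; B)` over all vertex sets
`B`. -/
noncomputable def throttlingNumber {V : Type*} (G : SimpleGraph V) : ℕ∞ :=
  ⨅ B : Finset V, ((B.card : ℕ∞) + propTime G (B : Set V))

/-- `M` is a `(k₁, …, k_r)`-kangaroo. -/
def IsKangaroo {U : Type*} (M : SimpleGraph U) {r : ℕ} (k : Fin r → ℕ) : Prop :=
  (∀ i, 1 ≤ k i) ∧
  ∃ S T : Fin r → Finset U,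
    (∀ i, (S i).card = k i + 1) ∧
    (∀ i, (T i).card = k i + 1) ∧
    (∀ u : U, ∃ i, u ∈ S i ∨ u ∈ T i) ∧
    (∀ i j, i ≠ j → Disjoint (S i) (S j)) ∧
    (∀ i j, i ≠ j → Disjoint (T i) (T j)) ∧
    (∀ i j, i ≤ j → Disjoint (S i) (T j)) ∧
    (∀ i j, i ≤ j → ∀ u ∈ S i, ∀ v ∈ T j, ¬ M.Adj u v) ∧
    (∀ i j : Fin r, (i : ℕ) + 1 = (j : ℕ) → ∀ u ∈ S j, u ∈ T i ∨ ∃ v ∈ T i, M.Adj v u)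

/-- `M` belongs to the family `𝒢_m`: it is a `(k₁, …, k_r)`-kangaroo for some positive integers
`k₁, …, k_r` with `k₁ + ⋯ + k_r = m + 1`. -/
def InKangarooFamily {U : Type*} (m : ℕ) (M : SimpleGraph U) : Prop :=
  ∃ (r : ℕ) (k : Fin r → ℕ), ∑ i, k i = m + 1 ∧ IsKangaroo M k

/-- `G` contains a graph in `𝒢_m` as an induced subgraph. -/
def ContainsKangaroo {V : Type*} (m : ℕ) (G : SimpleGraph V) : Prop :=
  ∃ W : Set V, InKangarooFamily m (G.induce W)

end Hopping

namespace Hopping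

/-! Look at the complement `T` of the initial blue set `B`. Propagation from `B` in `t` steps
amounts to a hop scheme on `T` with levels below `t`, so the throttling number drops below `|V| - k`
exactly when some scheme has at least `k + 1` more vertices than used levels. In a kangaroo, `T i`
is the set coloured in one step and `S i` the set of its forcers; `k i` is the gain of that step
over its unit of time, so the total gain is `k + 1`.

Matching each `S i` with `T i` turns a kangaroo into a scheme. Conversely, take a scheme of
sufficient gain minimising the sum of `l w + 1`: deleting a vertex or lowering a level would
contradict minimality, which yields exact gain, `1 ≤ k i` and domination (`exists_tightScheme`). -/

/-- The vertices in `T` are to be forced, `w` by `f w` in time step `l w + 1`, and the forcing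
vertex `f w` lies neither in nor next to the part of `T` which is still white by then. -/
structure IsHopScheme {V : Type*} (G : SimpleGraph V) (T : Finset V) (f : V → V) (l : V → ℕ) :
    Prop where
  injOn : Set.InjOn f T
  ne : ∀ w ∈ T, ∀ x ∈ T, l w ≤ l x → f w ≠ x
  not_adj : ∀ w ∈ T, ∀ x ∈ T, l w ≤ l x → ¬ G.Adj (f w) x

lemma IsHopScheme.mono {V : Type*} {G : SimpleGraph V} {T T' : Finset V} {f : V → V} {l : V → ℕ}
    (h : IsHopScheme G T f l) (hT : T' ⊆ T) : IsHopScheme G T' f l :=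
  ⟨h.injOn.mono (by exact_mod_cast hT), fun w hw x hx => h.ne w (hT hw) x (hT hx),
    fun w hw x hx => h.not_adj w (hT hw) x (hT hx)⟩

/-! ### From propagation to hop schemes -/

lemma IsForceSequence.right_unique {V : Type*} {G : SimpleGraph V} {B : Set V}
    {L : List (V × V)} (h : IsForceSequence G B L) {v w x : V} (hw : (v, w) ∈ L)
    (hx : (v, x) ∈ L) : w = x := by
  induction h with
  | nil => simp at hw
  | snoc L a b hL hab ih =>
    have ha : ∀ c, (a, c) ∉ L := fun c hc => hab.2.2.1 ⟨c, hc⟩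
    simp only [List.mem_append, List.mem_singleton, Prod.mk.injEq] at hw hx
    rcases hw with hw | ⟨rfl, rfl⟩ <;> rcases hx with hx | ⟨h1, h2⟩
    · exact ih hw hx
    · exact absurd (h1 ▸ hw) (ha _)
    · exact absurd hx (ha _)
    · exact h2.symm

lemma blueAt_mono {V : Type*} (G : SimpleGraph V) (B : Set V) (F : Set (V × V)) :
    Monotone (blueAt G B F) :=
  monotone_nat_of_le_succ fun _ => Set.subset_union_left

/-- Let `l w` be the last time at which `w` is still white, and `f w` a vertex forcing it then. A
vertex of level at least `l w` is white at time `l w`, hence cannot be `f w` or a neighbour of it.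
-/
lemma exists_scheme_of_blueAt_eq_univ {V : Type*} [Fintype V] {G : SimpleGraph V} {B : Finset V}
    {F : Set (V × V)} (hF : IsSetOfForces G (B : Set V) F) {t : ℕ}
    (ht : blueAt G (B : Set V) F t = Set.univ) :
    ∃ (T : Finset V) (f : V → V) (l : V → ℕ), IsHopScheme G T f l ∧ (∀ w ∈ T, l w < t) ∧
      T.card + B.card = Fintype.card V := by
  classical
  have key : ∀ w : V, ∃ (s : ℕ) (v : V), w ∉ B → s < t ∧ (v, w) ∈ F ∧
      w ∉ blueAt G (B : Set V) F s ∧ v ∈ blueAt G (B : Set V) F s ∧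
      G.neighborSet v ⊆ blueAt G (B : Set V) F s := by
    intro w
    by_cases hw : w ∈ B
    · exact ⟨0, w, fun h => absurd hw h⟩
    have hex : ∃ s, w ∈ blueAt G (B : Set V) F s := ⟨t, ht ▸ Set.mem_univ w⟩
    have hspec := Nat.find_spec hex
    have hle : Nat.find hex ≤ t := Nat.find_min' hex (ht ▸ Set.mem_univ w)
    have hmin : ∀ m, m < Nat.find hex → w ∉ blueAt G (B : Set V) F m :=
      fun m hm => Nat.find_min hex hm
    generalize Nat.find hex = m at hspec hle hmin
    cases m with
    | zero => exact absurd (by simpa [blueAt] using hspec) hw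
    | succ s =>
      have hs := hmin s s.lt_succ_self
      rcases hspec with h | ⟨v, hv, hc⟩
      · exact absurd h hs
      · exact ⟨s, v, fun _ => ⟨hle, hv, hs, hc.1, hc.2.2.2⟩⟩
  choose l f h using key
  obtain ⟨L, hL, rfl⟩ := hF
  refine ⟨Finset.univ \ B, f, l, ⟨?_, ?_, ?_⟩, ?_, ?_⟩
  · intro w hw x hx hwx
    have h1 := (h w (by simpa using hw)).2.1
    have h2 := (h x (by simpa using hx)).2.1
    exact hL.1.right_unique h1 (hwx ▸ h2)
  · rintro w hw x hx hwx rfl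
    exact (h _ (by simpa using hx)).2.2.1
      (blueAt_mono _ _ _ hwx (h w (by simpa using hw)).2.2.2.1)
  · intro w hw x hx hwx hadj
    exact (h _ (by simpa using hx)).2.2.1
      (blueAt_mono _ _ _ hwx ((h w (by simpa using hw)).2.2.2.2 hadj))
  · intro w hw
    exact (h w (by simpa using hw)).1
  · rw [Finset.card_sdiff_add_card_eq_card (Finset.subset_univ _), Finset.card_univ]

lemma exists_scheme_of_throttlingNumber_lt {V : Type*} [Fintype V] {G : SimpleGraph V} {k : ℕ}
    (h : throttlingNumber G + (k : ℕ∞) < (Fintype.card V : ℕ∞)) :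
    ∃ (T : Finset V) (f : V → V) (l : V → ℕ), IsHopScheme G T f l ∧
      (T.image l).card + (k + 1) ≤ T.card := by
  have h' : throttlingNumber G < ((Fintype.card V - k : ℕ) : ℕ∞) := by
    have hne : throttlingNumber G ≠ ⊤ := by
      intro ht
      simp [ht] at h
    lift throttlingNumber G to ℕ using hne with a
    norm_cast at h ⊢
    omega
  obtain ⟨B, hB⟩ := iInf_lt_iff.1 h'
  have hne : propTime G (B : Set V) ≠ ⊤ := by
    intro ht
    simp [ht] at hB
  have hB' : propTime G (B : Set V) < ((Fintype.card V - k - B.card : ℕ) : ℕ∞) := by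
    lift propTime G (B : Set V) to ℕ using hne with a
    norm_cast at hB ⊢
    omega
  obtain ⟨F, hF⟩ := iInf_lt_iff.1 hB'
  obtain ⟨hS, hF⟩ := iInf_lt_iff.1 hF
  obtain ⟨t, ht⟩ := iInf_lt_iff.1 hF
  obtain ⟨hu, ht⟩ := iInf_lt_iff.1 ht
  obtain ⟨T, f, l, hs, hl, hc⟩ := exists_scheme_of_blueAt_eq_univ hS hu
  refine ⟨T, f, l, hs, ?_⟩
  have h1 : (T.image l).card ≤ t := by
    rw [← Finset.card_range t]
    exact Finset.card_le_card fun x hx => by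
      obtain ⟨w, hw, rfl⟩ := Finset.mem_image.1 hx
      exact Finset.mem_range.2 (hl w hw)
  norm_cast at ht
  omega

/-! ### From hop schemes to propagation -/

/-- Forces in order of level are valid one at a time: those of equal level do not obstruct each
other. The induction runs over sets `A` closed downwards in level, removing a vertex of maximal
level. -/
lemma IsHopScheme.exists_forceSequence {V : Type*} [Fintype V] {G : SimpleGraph V} {T : Finset V}
    {f : V → V} {l : V → ℕ} (h : IsHopScheme G T f l) (n : ℕ) :
    ∀ A ⊆ T, A.card = n → (∀ a ∈ A, ∀ b ∈ T, l b < l a → b ∈ A) →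
      ∃ L : List (V × V), IsForceSequence G ((T : Set V)ᶜ) L ∧
        ∀ v w, (v, w) ∈ L ↔ w ∈ A ∧ v = f w := by
  classical
  induction n with
  | zero =>
    intro A _ hA _
    rw [Finset.card_eq_zero] at hA
    exact ⟨[], .nil, by simp [hA]⟩
  | succ n ih =>
    intro A hAT hA hdown
    obtain ⟨a, ha, hmax⟩ := A.exists_max_image l (Finset.card_pos.1 (by omega))
    obtain ⟨L, hL, hmem⟩ := ih (A.erase a) ((A.erase_subset a).trans hAT)
      (by rw [Finset.card_erase_of_mem ha]; omega) (by
        intro b hb c hc hcb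
        have hb' := Finset.mem_of_mem_erase hb
        refine Finset.mem_erase.2 ⟨?_, hdown b hb' c hc hcb⟩
        rintro rfl
        exact absurd (hmax b hb') (by omega))
    have hblue : ∀ x, (x ∈ T → l a ≤ l x → False) →
        x ∈ blueAfter ((T : Set V)ᶜ) L := by
      intro x hx
      by_cases hxT : x ∈ T
      · right
        have hlt : l x < l a := not_le.1 fun hle => hx hxT hle
        refine ⟨f x, (hmem _ _).2 ⟨Finset.mem_erase.2 ⟨?_, hdown a ha x hxT hlt⟩, rfl⟩⟩
        rintro rfl
        exact lt_irrefl _ hlt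
      · exact Or.inl hxT
    refine ⟨L ++ [(f a, a)], .snoc L _ _ hL ⟨?_, ?_, ?_, ?_⟩, ?_⟩
    · exact hblue _ fun hx hle => h.ne a (hAT ha) _ hx hle rfl
    · rintro (hx | ⟨v, hv⟩)
      · exact hx (hAT ha)
      · exact absurd ((hmem _ _).1 hv).1 (Finset.notMem_erase a A)
    · rintro ⟨w, hw⟩
      obtain ⟨hw, hf⟩ := (hmem _ _).1 hw
      have hwA := Finset.mem_of_mem_erase hw
      exact Finset.ne_of_mem_erase hw (h.injOn (hAT hwA) (hAT ha) hf.symm)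
    · exact fun x hx => hblue x fun hxT hle => h.not_adj a (hAT ha) x hxT hle hx
    · intro v w
      simp only [List.mem_append, hmem, List.mem_singleton, Prod.mk.injEq, Finset.mem_erase]
      constructor
      · rintro (⟨⟨-, hw⟩, rfl⟩ | ⟨rfl, rfl⟩)
        exacts [⟨hw, rfl⟩, ⟨ha, rfl⟩]
      · rintro ⟨hw, rfl⟩
        by_cases hwa : w = a
        · exact Or.inr ⟨by rw [hwa], hwa⟩
        · exact Or.inl ⟨⟨hwa, hw⟩, rfl⟩

lemma IsHopScheme.throttlingNumber_le {V : Type*} [Fintype V] {G : SimpleGraph V} {T : Finset V}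
    {f : V → V} {l : V → ℕ} (h : IsHopScheme G T f l) {r : ℕ} (hr : ∀ w ∈ T, l w < r) :
    throttlingNumber G ≤ ((Fintype.card V - T.card + r : ℕ) : ℕ∞) := by
  classical
  obtain ⟨L, hL, hmem⟩ := h.exists_forceSequence _ T subset_rfl rfl fun _ _ b hb _ => hb
  have hcoe : ((Tᶜ : Finset V) : Set V) = (T : Set V)ᶜ := Finset.coe_compl T
  have hF : IsSetOfForces G ((Tᶜ : Finset V) : Set V) {e | e ∈ L} := by
    rw [hcoe]
    refine ⟨L, ⟨hL, fun v w hvw => hvw.2.1 ?_⟩, rfl⟩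
    by_cases hw : w ∈ T
    · exact Or.inr ⟨f w, (hmem _ _).2 ⟨hw, rfl⟩⟩
    · exact Or.inl hw
  have hblue : ∀ t x, (x ∈ T → l x < t) →
      x ∈ blueAt G ((Tᶜ : Finset V) : Set V) {e | e ∈ L} t := by
    intro t
    induction t with
    | zero =>
      intro x hx
      rw [hcoe]
      exact fun hxT => absurd (hx hxT) (by omega)
    | succ t ih =>
      intro x hx
      by_cases hb : x ∈ blueAt G ((Tᶜ : Finset V) : Set V) {e | e ∈ L} t
      · exact Or.inl hb
      have hxT : x ∈ T := by
        by_contra hxT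
        exact hb (ih x fun h => absurd h hxT)
      have hxt := hx hxT
      -- The forcer is unspent: by injectivity of `f` its only target is `x`, still white.
      refine Or.inr ⟨f x, (hmem _ _).2 ⟨hxT, rfl⟩, ?_, hb, ?_, ?_⟩
      · refine ih _ fun hfT => ?_
        by_contra hlt
        exact h.ne x hxT _ hfT (by omega) rfl
      · rintro ⟨y, hy, hmy⟩
        obtain ⟨hyT, hf⟩ := (hmem _ _).1 hmy
        exact hb (h.injOn hxT hyT hf ▸ hy)
      · intro y hy
        refine ih _ fun hyT => ?_
        by_contra hlt
        exact h.not_adj x hxT _ hyT (by omega) hy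
  have huniv : blueAt G ((Tᶜ : Finset V) : Set V) {e | e ∈ L} r = Set.univ :=
    Set.eq_univ_of_forall fun x => hblue r x (hr x)
  refine (iInf_le _ (Tᶜ : Finset V)).trans ?_
  rw [Nat.cast_add, ← Finset.card_compl]
  gcongr
  exact (iInf₂_le _ hF).trans (iInf₂_le (f := fun (t : ℕ) _ => (t : ℕ∞)) r huniv)

lemma throttlingNumber_le_card {V : Type*} [Fintype V] (G : SimpleGraph V) :
    throttlingNumber G ≤ (Fintype.card V : ℕ∞) := by
  have h : IsHopScheme G ∅ id (fun _ => 0) := ⟨by simp, by simp, by simp⟩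
  simpa using h.throttlingNumber_le (r := 0) (by simp)

/-! ### Hop schemes and kangaroos -/

lemma exists_scheme_of_containsKangaroo {V : Type*} [Fintype V] {G : SimpleGraph V} {m : ℕ}
    (h : ContainsKangaroo m G) :
    ∃ (T : Finset V) (f : V → V) (l : V → ℕ) (r : ℕ), IsHopScheme G T f l ∧
      (∀ w ∈ T, l w < r) ∧ T.card = r + (m + 1) := by
  classical
  obtain ⟨W, r, k, hk, -, S, T, hS, hT, -, hSd, hTd, hST, hadj, -⟩ := h
  let e : ∀ i, T i ≃ S i := fun i => Finset.equivOfCardEq ((hT i).trans (hS i).symm)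
  -- Disjointness of the `T j` makes level and forcer well defined; outside them the values are
  -- arbitrary.
  have hchoice : ∀ w : V, ∃ (i : ℕ) (v : V), ∀ j, ∀ hw : w ∈ W, ∀ hT : ⟨w, hw⟩ ∈ T j,
      i = j ∧ v = (e j ⟨⟨w, hw⟩, hT⟩ : S j).1.1 := by
    intro w
    by_cases hex : ∃ j, ∃ hw : w ∈ W, ⟨w, hw⟩ ∈ T j
    · obtain ⟨j, hw, hj⟩ := hex
      refine ⟨j, (e j ⟨⟨w, hw⟩, hj⟩ : S j).1.1, fun j' hw' hj' => ?_⟩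
      have : j = j' := by
        by_contra hne
        exact Finset.disjoint_left.1 (hTd j j' hne) hj hj'
      subst this
      exact ⟨rfl, rfl⟩
    · exact ⟨0, w, fun j hw hj => absurd ⟨j, hw, hj⟩ hex⟩
  choose l f hlf using hchoice
  let T' : Finset W := Finset.univ.biUnion T
  have hmem : ∀ w ∈ T'.map (Function.Embedding.subtype _), ∃ (j : Fin r) (hw : w ∈ W)
      (hj : (⟨w, hw⟩ : W) ∈ T j), l w = j ∧ f w = (e j ⟨⟨w, hw⟩, hj⟩ : S j).1.1 := by
    intro w hw
    obtain ⟨⟨x, hx⟩, hxT, rfl⟩ := Finset.mem_map.1 hw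
    obtain ⟨j, -, hj⟩ := Finset.mem_biUnion.1 hxT
    exact ⟨j, hx, hj, hlf x j hx hj⟩
  refine ⟨T'.map (Function.Embedding.subtype _), f, l, r, ⟨?_, ?_, ?_⟩, ?_, ?_⟩
  · intro w hw x hx hfwx
    obtain ⟨i, hw, hi, -, hfw⟩ := hmem w hw
    obtain ⟨j, hx, hj, -, hfx⟩ := hmem x hx
    rw [hfw, hfx] at hfwx
    have hfwx := Subtype.ext hfwx
    have hij : i = j := by
      by_contra hne
      exact Finset.disjoint_left.1 (hSd i j hne) (e i ⟨⟨w, hw⟩, hi⟩).2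
        (hfwx ▸ (e j ⟨⟨x, hx⟩, hj⟩).2)
    subst hij
    simpa using (e i).injective (Subtype.ext hfwx)
  · intro w hw x hx hle hfx
    obtain ⟨i, hw, hi, hlw, hfw⟩ := hmem w hw
    obtain ⟨j, hx, hj, hlx, -⟩ := hmem x hx
    have hij : i ≤ j := by rw [hlw, hlx] at hle; exact hle
    refine Finset.disjoint_left.1 (hST i j hij) (e i ⟨⟨w, hw⟩, hi⟩).2 ?_
    have : (e i ⟨⟨w, hw⟩, hi⟩ : S i).1 = ⟨x, hx⟩ := Subtype.ext (hfw.symm.trans hfx)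
    rwa [this]
  · intro w hw x hx hle hfx
    obtain ⟨i, hw, hi, hlw, hfw⟩ := hmem w hw
    obtain ⟨j, hx, hj, hlx, -⟩ := hmem x hx
    have hij : i ≤ j := by rw [hlw, hlx] at hle; exact hle
    refine hadj i j hij _ (e i ⟨⟨w, hw⟩, hi⟩).2 _ hj ?_
    rw [hfw] at hfx
    exact hfx
  · intro w hw
    obtain ⟨i, -, -, hlw, -⟩ := hmem w hw
    rw [hlw]
    exact i.2
  · rw [Finset.card_map, Finset.card_biUnion fun i _ j _ hij => hTd i j hij,
      Finset.sum_congr rfl fun i _ => hT i, Finset.sum_add_distrib, hk]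
    simp [add_comm]

/-- A hop scheme in which every step in use makes at least two vertices blue, the steps in use are
consecutive, and no force could be performed one step earlier. -/
structure IsTightScheme {V : Type*} (G : SimpleGraph V) (T : Finset V) (f : V → V) (l : V → ℕ) :
    Prop extends IsHopScheme G T f l where
  exists_ne : ∀ w ∈ T, ∃ x ∈ T, x ≠ w ∧ l x = l w
  exists_pred : ∀ w ∈ T, ∀ n, l w = n + 1 → ∃ x ∈ T, l x = n
  dominated : ∀ w ∈ T, ∀ n, l w = n + 1 → ∃ x ∈ T, l x = n ∧ (f w = x ∨ G.Adj (f w) x)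

lemma exists_tightScheme {V : Type*} [Fintype V] {G : SimpleGraph V} {m : ℕ}
    (h : ∃ (T : Finset V) (f : V → V) (l : V → ℕ), IsHopScheme G T f l ∧
      (T.image l).card + (m + 1) ≤ T.card) :
    ∃ (T : Finset V) (f : V → V) (l : V → ℕ), IsTightScheme G T f l ∧
      (T.image l).card + (m + 1) = T.card := by
  classical
  -- The summand `l w + 1`, rather than `l w`, makes deleting a vertex of level `0` a strict
  -- decrease.
  have hex : ∃ (N : ℕ) (T : Finset V) (f : V → V) (l : V → ℕ), IsHopScheme G T f l ∧
      (T.image l).card + (m + 1) ≤ T.card ∧ ∑ w ∈ T, (l w + 1) = N := by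
    obtain ⟨T, f, l, h1, h2⟩ := h
    exact ⟨_, T, f, l, h1, h2, rfl⟩
  obtain ⟨T, f, l, hs, hc, hN⟩ := Nat.find_spec hex
  have hmin : ∀ (T' : Finset V) (l' : V → ℕ), IsHopScheme G T' f l' →
      (T'.image l').card + (m + 1) ≤ T'.card →
      ∑ w ∈ T, (l w + 1) ≤ ∑ w ∈ T', (l' w + 1) := by
    intro T' l' h1 h2
    rw [hN]
    exact Nat.find_min' hex ⟨T', f, l', h1, h2, rfl⟩
  have herase : ∀ w ∈ T, T.card ≤ ((T.erase w).image l).card + (m + 1) := by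
    intro w hw
    by_contra hlt
    have h1 := hmin (T.erase w) l (hs.mono (T.erase_subset w))
      (by rw [Finset.card_erase_of_mem hw]; omega)
    have h2 := Finset.add_sum_erase T (fun w => l w + 1) hw
    omega
  have hother : ∀ w ∈ T, ∃ x ∈ T, x ≠ w ∧ l x = l w := by
    intro w hw
    by_contra! hne
    have h1 : ((T.erase w).image l) ⊆ (T.image l).erase (l w) := by
      intro y hy
      obtain ⟨x, hx, rfl⟩ := Finset.mem_image.1 hy
      obtain ⟨hxw, hx⟩ := Finset.mem_erase.1 hx
      exact Finset.mem_erase.2 ⟨hne x hx hxw, Finset.mem_image_of_mem l hx⟩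
    have h2 := Finset.card_le_card h1
    have h3 : l w ∈ T.image l := Finset.mem_image_of_mem l hw
    rw [Finset.card_erase_of_mem h3] at h2
    have h4 := Finset.card_pos.2 ⟨_, h3⟩
    have h5 := herase w hw
    omega
  have hpred : ∀ w ∈ T, ∀ n, l w = n + 1 → ∃ x ∈ T, l x = n := by
    intro w hw n hn
    by_contra! hne
    -- Moving level `n + 1` into the empty level `n` keeps the order of levels.
    let g : ℕ → ℕ := fun i => if i = n + 1 then n else i
    have hg : ∀ x ∈ T, ∀ y ∈ T, g (l x) ≤ g (l y) → l x ≤ l y := by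
      intro x hx y hy hxy
      have h1 := hne x hx
      have h2 := hne y hy
      simp only [g] at hxy
      split_ifs at hxy <;> omega
    have h1 := hmin T (fun x => g (l x))
      ⟨hs.injOn, fun x hx y hy hxy => hs.ne x hx y hy (hg x hx y hy hxy),
        fun x hx y hy hxy => hs.not_adj x hx y hy (hg x hx y hy hxy)⟩ (by
        have : T.image (fun x => g (l x)) = (T.image l).image g := by
          rw [Finset.image_image]; rfl
        rw [this]
        have := Finset.card_image_le (s := T.image l) (f := g)
        omega)
    have hle : ∀ i, g i ≤ i := by
      intro i
      simp only [g]
      split_ifs <;> omega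
    have h2 : ∑ x ∈ T, (g (l x) + 1) < ∑ x ∈ T, (l x + 1) :=
      Finset.sum_lt_sum (fun x _ => by have := hle (l x); omega)
        ⟨w, hw, by simp [g, hn]⟩
    omega
  refine ⟨T, f, l, ⟨hs, hother, hpred, ?_⟩, ?_⟩
  -- An undominated forcer could act one step earlier. Lowering `w` alone to level `n` opens no new
  -- level, since `n` is already in use.
  · intro w hw n hn
    by_contra! hne
    obtain ⟨z, hz, hzn⟩ := hpred w hw n hn
    obtain ⟨y, hy, hyw, hly⟩ := hother w hw
    have hup : ∀ x, x ≠ w → Function.update l w n x = l x := fun x hx =>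
      Function.update_of_ne hx _ _
    have hlow : ∀ x, Function.update l w n x ≤ l x := by
      intro x
      by_cases hx : x = w
      · subst hx; simp [hn]
      · rw [hup x hx]
    have hcmp : ∀ x ∈ T, ∀ y ∈ T, Function.update l w n x ≤ Function.update l w n y →
        l x ≤ l y ∨ (x = w ∧ l y = n) := by
      intro x _ y _ hxy
      by_cases hx : x = w
      · subst hx
        have := hlow y
        rw [Function.update_self] at hxy
        by_cases hy : l y = n
        · exact Or.inr ⟨rfl, hy⟩
        · left; omega
      · rw [hup x hx] at hxy
        exact Or.inl (hxy.trans (hlow y))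
    have h1 := hmin T (Function.update l w n) ⟨hs.injOn, ?_, ?_⟩ ?_
    · have h2 : ∑ x ∈ T, (Function.update l w n x + 1) < ∑ x ∈ T, (l x + 1) :=
        Finset.sum_lt_sum (fun x _ => by have := hlow x; omega) ⟨w, hw, by simp [hn]⟩
      omega
    · intro x hx y hy hxy
      rcases hcmp x hx y hy hxy with h | ⟨rfl, h⟩
      · exact hs.ne x hx y hy h
      · exact (hne y hy h).1
    · intro x hx y hy hxy
      rcases hcmp x hx y hy hxy with h | ⟨rfl, h⟩
      · exact hs.not_adj x hx y hy h
      · exact (hne y hy h).2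
    · have hsub : T.image (Function.update l w n) ⊆ T.image l := by
        intro i hi
        obtain ⟨x, hx, rfl⟩ := Finset.mem_image.1 hi
        by_cases hxw : x = w
        · subst hxw
          rw [Function.update_self, ← hzn]
          exact Finset.mem_image_of_mem l hz
        · rw [hup x hxw]
          exact Finset.mem_image_of_mem l hx
      have := Finset.card_le_card hsub
      omega
  · obtain ⟨w, hw⟩ : T.Nonempty := Finset.card_pos.1 (by omega)
    have h1 := herase w hw
    have h2 := Finset.card_le_card (Finset.image_subset_image (f := l) (T.erase_subset w))
    omega

lemma eq_range_of_pred_mem (A : Finset ℕ) (h : ∀ n, n + 1 ∈ A → n ∈ A) :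
    A = Finset.range A.card := by
  have hdown : ∀ a ∈ A, ∀ b ≤ a, b ∈ A := fun a ha b hb =>
    Nat.decreasingInduction' (P := (· ∈ A)) (fun n _ _ hn => h n hn) hb ha
  refine Finset.eq_of_subset_of_card_le (fun a ha => Finset.mem_range.2 ?_) (by simp)
  have hsub : Finset.range (a + 1) ⊆ A := fun b hb =>
    hdown a ha b (Nat.lt_succ_iff.1 (Finset.mem_range.1 hb))
  simpa using Finset.card_le_card hsub

lemma IsTightScheme.containsKangaroo {V : Type*} [Fintype V] {G : SimpleGraph V} {m : ℕ}
    {T : Finset V} {f : V → V} {l : V → ℕ} (h : IsTightScheme G T f l)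
    (hc : (T.image l).card + (m + 1) = T.card) : ContainsKangaroo m G := by
  classical
  let W : Set V := {u | u ∈ T ∨ ∃ w ∈ T, f w = u}
  let fiber : ℕ → Finset V := fun i => T.filter fun w => l w = i
  have himage : T.image l = Finset.range (T.image l).card := by
    refine eq_range_of_pred_mem _ fun n hn => ?_
    obtain ⟨w, hw, hwn⟩ := Finset.mem_image.1 hn
    obtain ⟨x, hx, rfl⟩ := h.exists_pred w hw n hwn
    exact Finset.mem_image_of_mem l hx
  have hlt : ∀ w ∈ T, l w < (T.image l).card := fun w hw =>
    Finset.mem_range.1 (himage ▸ Finset.mem_image_of_mem l hw)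
  have htwo : ∀ i : Fin (T.image l).card, 2 ≤ (fiber i).card := by
    intro i
    have hi : (i : ℕ) ∈ T.image l := himage.ge (Finset.mem_range.2 i.2)
    obtain ⟨w, hw, hwi⟩ := Finset.mem_image.1 hi
    obtain ⟨x, hx, hxw, hlx⟩ := h.exists_ne w hw
    exact Finset.one_lt_card.2 ⟨x, Finset.mem_filter.2 ⟨hx, hlx.trans hwi⟩, w,
      Finset.mem_filter.2 ⟨hw, hwi⟩, hxw⟩
  have hsum : ∑ i : Fin (T.image l).card, (fiber i).card = T.card := by
    rw [Fin.sum_univ_eq_sum_range (fun i => (fiber i).card), ← himage]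
    exact (Finset.card_eq_sum_card_image l T).symm
  have hWT : ∀ i, ∀ w ∈ fiber i, w ∈ W := fun i w hw => Or.inl (Finset.mem_filter.1 hw).1
  have hWS : ∀ i, ∀ w ∈ (fiber i).image f, w ∈ W := by
    intro i u hu
    obtain ⟨w, hw, rfl⟩ := Finset.mem_image.1 hu
    exact Or.inr ⟨w, (Finset.mem_filter.1 hw).1, rfl⟩
  have hmemT : ∀ (i : ℕ) (u : W), u ∈ (fiber i).subtype (· ∈ W) ↔ u.1 ∈ T ∧ l u.1 = i := by
    intro i u
    simp [fiber]
  have hmemS : ∀ (i : ℕ) (u : W), u ∈ ((fiber i).image f).subtype (· ∈ W) ↔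
      ∃ w ∈ T, l w = i ∧ f w = u.1 := by
    intro i u
    simp [fiber, and_assoc]
  refine ⟨W, (T.image l).card, fun i => (fiber i).card - 1, ?_,
    fun i => by have := htwo i; simp only; omega,
    fun i => ((fiber i).image f).subtype (· ∈ W), fun i => (fiber i).subtype (· ∈ W),
    ?_, ?_, ?_, ?_, ?_, ?_, ?_, ?_⟩
  · have h1 : ∑ i : Fin (T.image l).card, (((fiber i).card - 1) + 1) = T.card := by
      rw [← hsum]
      exact Finset.sum_congr rfl fun i _ => by have := htwo i; omega
    rw [Finset.sum_add_distrib] at h1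
    change ∑ i : Fin (T.image l).card, ((fiber i).card - 1) = m + 1
    simp only [Finset.sum_const, Finset.card_univ, Fintype.card_fin, smul_eq_mul, mul_one] at h1
    omega
  · intro i
    have := htwo i
    change _ = (fiber i).card - 1 + 1
    rw [Finset.card_subtype, Finset.filter_true_of_mem (hWS i),
      Finset.card_image_of_injOn (h.injOn.mono (by
        exact_mod_cast Finset.filter_subset _ _))]
    omega
  · intro i
    have := htwo i
    change _ = (fiber i).card - 1 + 1
    rw [Finset.card_subtype, Finset.filter_true_of_mem (hWT i)]
    omega
  · rintro ⟨u, hu | ⟨w, hw, hwu⟩⟩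
    · exact ⟨⟨l u, hlt u hu⟩, Or.inr ((hmemT _ _).2 ⟨hu, rfl⟩)⟩
    · exact ⟨⟨l w, hlt w hw⟩, Or.inl ((hmemS _ _).2 ⟨w, hw, rfl, hwu⟩)⟩
  · intro i j hij
    refine Finset.disjoint_left.2 fun u hi hj => hij (Fin.ext ?_)
    obtain ⟨w, hw, hwi, hwu⟩ := (hmemS _ _).1 hi
    obtain ⟨x, hx, hxj, hxu⟩ := (hmemS _ _).1 hj
    rw [← hwi, ← hxj, h.injOn hw hx (hwu.trans hxu.symm)]
  · intro i j hij
    refine Finset.disjoint_left.2 fun u hi hj => hij (Fin.ext ?_)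
    exact ((hmemT _ _).1 hi).2.symm.trans ((hmemT _ _).1 hj).2
  · intro i j hij
    refine Finset.disjoint_left.2 fun u hi hj => ?_
    obtain ⟨w, hw, hwi, hwu⟩ := (hmemS _ _).1 hi
    obtain ⟨hu, huj⟩ := (hmemT _ _).1 hj
    exact h.ne w hw _ hu (by rw [hwi, huj]; exact hij) hwu
  · intro i j hij u hi v hj hadj
    obtain ⟨w, hw, hwi, hwu⟩ := (hmemS _ _).1 hi
    obtain ⟨hv, hvj⟩ := (hmemT _ _).1 hj
    exact h.not_adj w hw _ hv (by rw [hwi, hvj]; exact hij) (hwu ▸ hadj)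
  · intro i j hij u hu
    obtain ⟨w, hw, hwj, hwu⟩ := (hmemS _ _).1 hu
    obtain ⟨x, hx, hxi, hfx⟩ := h.dominated w hw i (hwj.trans hij.symm)
    rw [hwu] at hfx
    rcases hfx with hfx | hfx
    · exact Or.inl ((hmemT _ _).2 ⟨hfx ▸ hx, hfx ▸ hxi⟩)
    · exact Or.inr ⟨⟨x, Or.inl hx⟩, (hmemT _ _).2 ⟨hx, hxi⟩, hfx.symm⟩

lemma throttlingNumber_add_lt_iff {V : Type*} [Fintype V] (G : SimpleGraph V) (k : ℕ) :
    throttlingNumber G + (k : ℕ∞) < (Fintype.card V : ℕ∞) ↔ ContainsKangaroo k G := by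
  constructor
  · intro h
    obtain ⟨T, f, l, hT, hc⟩ := exists_tightScheme (exists_scheme_of_throttlingNumber_lt h)
    exact hT.containsKangaroo hc
  · intro h
    obtain ⟨T, f, l, r, hs, hr, hc⟩ := exists_scheme_of_containsKangaroo h
    refine (add_le_add_left (hs.throttlingNumber_le hr) _).trans_lt ?_
    -- This keeps the natural subtraction `|V| - |T|` from truncating.
    have := T.card_le_univ
    norm_cast
    omega

end Hopping

theorem mainTheorem5 {V : Type*} [Fintype V] (G : SimpleGraph V) (k : ℕ) :
    ((Fintype.card V : ℕ∞) ≤ Hopping.throttlingNumber G + (k : ℕ∞) ↔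
      ¬ Hopping.ContainsKangaroo k G) ∧
    (Hopping.throttlingNumber G + (k : ℕ∞) = (Fintype.card V : ℕ∞) ↔
      ¬ Hopping.ContainsKangaroo k G ∧ (k = 0 ∨ Hopping.ContainsKangaroo (k - 1) G)) := by
  have hle := Hopping.throttlingNumber_le_card G
  have h1 := Hopping.throttlingNumber_add_lt_iff G k
  have h2 := Hopping.throttlingNumber_add_lt_iff G (k - 1)
  rw [← h1, ← h2, not_lt]
  refine ⟨Iff.rfl, ?_⟩
  -- For `k = 0`, where `k - 1` truncates, the bound by `|V|` supplies the missing inequality.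
  lift Hopping.throttlingNumber G to ℕ using ne_top_of_le_ne_top (ENat.natCast_ne_top _) hle with a
  norm_cast at hle ⊢
  omega
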